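/- Graphs are finite and may have multiple edges and loops. A signed graph $(G,\sigma)$ is a graph $G$ with a signature $\sigma\colon E(G)\to\{\pm1\}$. Every edge consists of two half-edges, each incident with exactly one end of the edge; $H(v)$ denotes the set of half-edges incident with the vertex $v$, and $e_h$ the edge containing the half-edge $h$. An orientation of $(G,\sigma)$ is a mapping $\tau$ from the set of half-edges to $\{\pm1\}$ such that $\tau(h_1)\tau(h_2)=-\sigma(e)$ for every edge $e$ with half-edges $h_1,h_2$. For $f\colon E(G)\to\mathbb Z$ put $\partial f(v)=\sum_{h\in H(v)}f(e_h)\tau(h)$. Let $p$ be a positive integer. An integer-valued (respectively modulo) circular $(2+\frac1p)$-flow of $(G,\sigma)$ consists of an orientation $\tau$ and a mapping $f\colon E(G)\to\mathbb Z$ with $p\le|f(e)|\le p+1$ for every edge $e$ and $\partial f(v)=0$ (respectively $\partial f(v)\equiv0\pmod{2p+1}$) for every vertex $v$. The graph $G$ is odd-$(2p+1)$-edge-connected if no edge cut of $G$ (the set of all edges with exactly one end in some vertex set $X$) consists of an odd number $k\le 2p-1$ of edges. Theorem. If $(G,\sigma)$ is a signed graph such that $G$ is odd-$(2p+1)$-edge-connected,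 then $(G,\sigma)$ admits a modulo circular $(2+\frac1p)$-flow if and only if it admits an integer-valued circular $(2+\frac1p)$-flow. -/

import Mathlib

/-- A graph with vertices `V` and edges `E`, in which multiple edges and loops are allowed.
Every edge `e` consists of the two half-edges `(e, false)` and `(e, true)`, and `inc h` is the
vertex with which the half-edge `h` is incident. A loop has both half-edges at one vertex. -/
structure HalfEdgeGraph (V E : Type*) where
  /-- the vertex with which a half-edge is incident -/
  inc : E × Bool → V

namespace HalfEdgeGraph

variable {V E : Type*}

/-- `τ` is an orientation of the signed graph `(G, σ)`: the two half-edges of every edge `e`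
satisfy `τ h₁ * τ h₂ = - σ e`. The values `1, -1` are the units of `ℤ`. -/
def IsOrientation (_ : HalfEdgeGraph V E) (σ : E → ℤˣ) (τ : E × Bool → ℤˣ) : Prop :=
  ∀ e : E, τ (e, false) * τ (e, true) = - σ e

variable [DecidableEq V] [Fintype E]

/-- The edge cut of a vertex set `X`: the edges with exactly one end in `X`. -/
def edgeCut (G : HalfEdgeGraph V E) (X : Finset V) : Finset E :=
  Finset.univ.filter fun e => ¬ (G.inc (e, false) ∈ X ↔ G.inc (e, true) ∈ X)

/-- `F` is an odd-`k`-edge cut: an edge cut whose number of edges is `k`, where `k` is odd. -/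
def IsOddEdgeCut (G : HalfEdgeGraph V E) (k : ℕ) (F : Finset E) : Prop :=
  F.card = k ∧ Odd k ∧ ∃ X : Finset V, F = G.edgeCut X

/-- `G` is odd-`l`-edge-connected: it has no odd-`k`-edge cut with `k ≤ l - 2`. -/
def OddEdgeConnected (G : HalfEdgeGraph V E) (l : ℕ) : Prop :=
  ∀ k : ℕ, k + 2 ≤ l → ∀ F : Finset E, ¬ G.IsOddEdgeCut k F

/-- The boundary of `f` at `v`: the sum of `f e * τ h` over all half-edges `h` at `v`,
where `e` is the edge that contains `h`. -/
def boundary (G : HalfEdgeGraph V E) (τ : E × Bool → ℤˣ) (f : E → ℤ) (v : V) : ℤ :=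
  ∑ h : E × Bool with G.inc h = v, f h.1 * (τ h : ℤ)

/-- `f` is an integer-valued circular `k/d`-flow with respect to the orientation `τ`. -/
def IsIntegerCircularFlow (G : HalfEdgeGraph V E) (τ : E × Bool → ℤˣ) (k d : ℕ)
    (f : E → ℤ) : Prop :=
  (∀ e, (d : ℤ) ≤ |f e| ∧ |f e| ≤ (k : ℤ) - d) ∧ ∀ v, G.boundary τ f v = 0

/-- `f` is a modulo circular `k/d`-flow with respect to the orientation `τ`. -/
def IsModuloCircularFlow (G : HalfEdgeGraph V E) (τ : E × Bool → ℤˣ) (k d : ℕ)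
    (f : E → ℤ) : Prop :=
  (∀ e, (d : ℤ) ≤ |f e| ∧ |f e| ≤ (k : ℤ) - d) ∧ ∀ v, G.boundary τ f v ≡ 0 [ZMOD k]

/-- The signed graph `(G, σ)` admits an integer-valued circular `k/d`-flow. -/
def AdmitsIntegerCircularFlow (G : HalfEdgeGraph V E) (σ : E → ℤˣ) (k d : ℕ) : Prop :=
  ∃ τ : E × Bool → ℤˣ, G.IsOrientation σ τ ∧ ∃ f : E → ℤ, G.IsIntegerCircularFlow τ k d f

/-- The signed graph `(G, σ)` admits a modulo circular `k/d`-flow. -/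
def AdmitsModuloCircularFlow (G : HalfEdgeGraph V E) (σ : E → ℤˣ) (k d : ℕ) : Prop :=
  ∃ τ : E × Bool → ℤˣ, G.IsOrientation σ τ ∧ ∃ f : E → ℤ, G.IsModuloCircularFlow τ k d f

end HalfEdgeGraph

/-!
Reversing edges turns a modulo circular `(2 + 1/p)`-flow into an orientation `τ` with
`∑ τ h = (2 * p + 1) * c v` over the half-edges `h` at each vertex `v`
(`AdmitsModuloCircularFlow.exists_orientation`). If the edges outside a set `S` have signed degree
`(p + 1) * c v` at each `v`, then the value `-(p + 1)` on `S` and `p` elsewhere is an integer flow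
for `τ`. So it suffices to find `S`; one may assume `0 ≤ c v`, since reversing all signs
at a vertex changes nothing.

The set `S` comes from a perfect matching of the *gadget graph*, whose vertices are the half-edges
and `(p + 1) * c v` cores for each `v`: the two halves of an edge are adjacent, and at each `v` the
positive half-edges are completely joined to the negative half-edges and the cores. The set `S`
consists of the edges whose halves are matched to each other
(`exists_finset_of_isPerfectMatching`).

By Tutte's theorem, a perfect matching exists as soon as there is a fractional one that has weight
at least `1` on the boundary of every odd vertex set
(`SimpleGraph.exists_isPerfectMatching_of_weight`). Give the weight `p / (2 * p + 1)` to each edge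
of `G`, and distribute the remaining `q = (p + 1) / (2 * p + 1)` of each half-edge uniformly in its
gadget. An odd set that splits two gadgets, or a gadget and an edge, or three edges, has enough
boundary at once. If it splits no gadget, a parity count shows that it comes from an odd edge cut of
`G`, which has at least `2 * p + 1 ≥ 3` edges. If it splits a single gadget and no edge, parity
and odd-edge-connectivity show that both parts of the gadget contain a core or at least five
half-edges, and then the boundary inside the gadget has weight at least `1` (`one_le_cross`).
-/

section

open Finset

/-! ### A weighted form of Tutte's condition -/

/-- Tutte's condition follows from a fractional perfect matching: every odd component left after
deleting `u` sends total weight at least `1` into `u`, and `u` can absorb only `|u|`. -/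
theorem SimpleGraph.exists_isPerfectMatching_of_weight {W : Type*} [Fintype W] [DecidableEq W]
    (K : SimpleGraph W) (w : W → W → ℚ) (hnonneg : ∀ x y, 0 ≤ w x y)
    (hadj : ∀ x y, w x y ≠ 0 → K.Adj x y) (hle : ∀ y, ∑ x, w x y ≤ 1)
    (hodd : ∀ C : Finset W, Odd C.card → 1 ≤ ∑ x ∈ C, ∑ y ∈ Cᶜ, w x y) :
    ∃ M : K.Subgraph, M.IsPerfectMatching := by
  classical
  rw [SimpleGraph.tutte]
  intro u hu
  unfold SimpleGraph.IsTutteViolator at hu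
  set H := ((⊤ : K.Subgraph).deleteVerts u).coe with hH
  let S : H.ConnectedComponent → Finset W := fun c => (Subtype.val '' c.supp).toFinset
  have memS : ∀ c x, x ∈ S c ↔ ∃ hx, H.connectedComponentMk ⟨x, hx⟩ = c := by
    intro c x
    simp [S]
  have hcard : ∀ c ∈ H.oddComponents, Odd (S c).card := by
    intro c hc
    have : (S c).card = c.supp.ncard := by
      rw [← Set.ncard_eq_toFinset_card', Set.ncard_image_of_injective _ Subtype.val_injective]
    rw [this]
    exact hc
  have hdisj : ∀ c d, c ≠ d → Disjoint (S c) (S d) := by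
    intro c d hcd
    rw [Finset.disjoint_left]
    intro x hx hx'
    obtain ⟨_, h1⟩ := (memS c x).1 hx
    obtain ⟨_, h2⟩ := (memS d x).1 hx'
    exact hcd (h1.symm.trans h2)
  have hout : ∀ c x y, x ∈ S c → y ∉ S c → w x y ≠ 0 → y ∈ u.toFinset := by
    intro c x y hx hy hw
    by_contra hyu
    obtain ⟨hxv, h1⟩ := (memS c x).1 hx
    have hyv : y ∈ ((⊤ : K.Subgraph).deleteVerts u).verts := by simpa using hyu
    apply hy
    rw [memS]
    refine ⟨hyv, ?_⟩
    rw [← h1]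
    apply SimpleGraph.ConnectedComponent.sound
    apply SimpleGraph.Adj.reachable
    have := hadj x y hw
    simp only [SimpleGraph.Subgraph.verts_top, Set.mem_sdiff, Set.mem_univ, true_and,
      SimpleGraph.Subgraph.deleteVerts_verts] at hxv hyv
    simp [hH, this.symm, hxv, hyv]
  -- The weight leaving an odd component is at least `1` and goes to `u`.
  have hone : ∀ c ∈ H.oddComponents, 1 ≤ ∑ x ∈ S c, ∑ y ∈ u.toFinset, w x y := by
    intro c hc
    refine (hodd _ (hcard c hc)).trans (Finset.sum_le_sum fun x hx => ?_)
    rw [← Finset.sum_filter_ne_zero]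
    refine Finset.sum_le_sum_of_subset_of_nonneg (fun y hy => ?_) fun _ _ _ => hnonneg _ _
    simp only [Finset.mem_filter, Finset.mem_compl] at hy
    exact hout c x y hx hy.1 hy.2
  have key : (H.oddComponents.toFinset.card : ℚ) ≤ u.toFinset.card := by
    calc (H.oddComponents.toFinset.card : ℚ) = ∑ c ∈ H.oddComponents.toFinset, 1 := by simp
      _ ≤ ∑ c ∈ H.oddComponents.toFinset, ∑ x ∈ S c, ∑ y ∈ u.toFinset, w x y :=
          Finset.sum_le_sum fun c hc => hone c (by simpa using hc)
      _ = ∑ x ∈ H.oddComponents.toFinset.biUnion S, ∑ y ∈ u.toFinset, w x y := by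
          rw [Finset.sum_biUnion fun c _ d _ hcd => hdisj c d hcd]
      _ ≤ ∑ x, ∑ y ∈ u.toFinset, w x y :=
          Finset.sum_le_sum_of_subset_of_nonneg (Finset.subset_univ _)
            fun _ _ _ => Finset.sum_nonneg fun _ _ => hnonneg _ _
      _ = ∑ y ∈ u.toFinset, ∑ x, w x y := Finset.sum_comm
      _ ≤ ∑ y ∈ u.toFinset, 1 := Finset.sum_le_sum fun y _ => hle y
      _ = u.toFinset.card := by simp
  rw [Set.ncard_eq_toFinset_card', Set.ncard_eq_toFinset_card'] at hu
  have : H.oddComponents.toFinset.card ≤ u.toFinset.card := by exact_mod_cast key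
  omega

namespace HalfEdgeGraph

/-! ### Cuts in a complete bipartite graph with product weights -/

/-- Split a complete bipartite graph with product weights into two parts, of weights `a₁`, `b₁` and
`a₂`, `b₂` on the two sides. If each part has weight at least `q` on some side, and if nonzero
weights on the first side are at least `q`, then the weight between the parts, divided by the common
weight `a₁ + a₂` of the sides, is at least `q`. -/
theorem weight_le_cross {q a₁ a₂ b₁ b₂ : ℚ} (ha₁ : 0 ≤ a₁) (ha₂ : 0 ≤ a₂) (hb₁ : 0 ≤ b₁)
    (hb₂ : 0 ≤ b₂) (h : a₁ + a₂ = b₁ + b₂) (ha₁' : a₁ = 0 ∨ q ≤ a₁) (ha₂' : a₂ = 0 ∨ q ≤ a₂)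
    (h₁ : q ≤ a₁ ∨ q ≤ b₁) (h₂ : q ≤ a₂ ∨ q ≤ b₂) :
    q * (a₁ + a₂) ≤ a₁ * b₂ + b₁ * a₂ := by
  rcases ha₁' with rfl | h1
  · rcases h₁ with h1 | h1 <;> nlinarith
  · rcases ha₂' with rfl | h2
    · rcases h₂ with h2 | h2 <;> nlinarith
    · have e1 := mul_le_mul_of_nonneg_right h1 hb₂
      have e2 := mul_le_mul_of_nonneg_right h2 hb₁
      rw [h]
      linarith

/-- The case `a₁ ≤ 1` of `one_le_cross`, where only the hypothesis on the first part matters. -/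
theorem one_le_cross_of_le_one {p a₁ a₂ m₁ m₂ k₁ k₂ c : ℕ} {q : ℚ} (hp : 0 < p)
    (hq : q * (2 * p + 1) = p + 1)
    (ha : a₁ + a₂ = m₁ + m₂ + (2 * p + 1) * c) (hk : k₁ + k₂ = (p + 1) * c)
    (h₁ : 1 ≤ k₁ ∨ 5 ≤ a₁ + m₁) (hle : a₁ ≤ 1) :
    q * a₁ + q * a₂ ≤ (q * a₁) * (q * m₂ + k₂) + (q * m₁ + k₁) * (q * a₂) := by
  have hpQ : (1 : ℚ) ≤ p := by exact_mod_cast hp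
  have hq1 : 1 / 2 ≤ q := by nlinarith
  have haQ : (a₁ : ℚ) + a₂ = m₁ + m₂ + (2 * p + 1) * c := by exact_mod_cast ha
  have hkQ : (k₁ : ℚ) + k₂ = (p + 1) * c := by exact_mod_cast hk
  have hbal : q * m₂ + k₂ = q * a₁ + q * a₂ - (q * m₁ + k₁) := by
    linear_combination hkQ - q * haQ - (c : ℚ) * hq
  have hk0 : (0 : ℚ) ≤ k₁ := Nat.cast_nonneg _
  have hm0 : (0 : ℚ) ≤ m₁ := Nat.cast_nonneg _
  have ha0 : (0 : ℚ) ≤ a₂ := Nat.cast_nonneg _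
  have hqa : 0 ≤ q * a₂ := by positivity
  have hqm : 0 ≤ q * m₁ := by positivity
  rw [hbal]
  obtain rfl | rfl : a₁ = 0 ∨ a₁ = 1 := by omega
  · have hY : 1 ≤ q * m₁ + k₁ := by
      rcases h₁ with h | h
      · have : (1 : ℚ) ≤ k₁ := by exact_mod_cast h
        linarith
      · have : (5 : ℚ) ≤ m₁ := by exact_mod_cast (by omega : 5 ≤ m₁)
        nlinarith
    push_cast
    nlinarith
  · -- After division by `q`, the claim is equivalent to `key`.
    have key : (1 - q) * (1 + a₂) ≤ (q * m₁ + k₁) * (a₂ - 1) := by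
      rcases h₁ with h | h
      · -- A core exists only if `c ≠ 0`, and then the large side has many half-edges.
        have hc : 1 ≤ c := by
          rcases Nat.eq_zero_or_pos c with rfl | hc
          · omega
          · exact hc
        have h2 : 2 * p ≤ a₂ := by nlinarith
        have h2' : (2 : ℚ) * p ≤ a₂ := by exact_mod_cast h2
        have h1 : (1 : ℚ) ≤ k₁ := by exact_mod_cast h
        have e1 : (a₂ : ℚ) - 1 ≤ (q * m₁ + k₁) * (a₂ - 1) := by nlinarith
        refine le_trans ?_ e1
        have e2 : (1 - q) * (2 * p + 1) = p := by linear_combination -hq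
        have e3 : (1 - q) * (1 + a₂) * (2 * p + 1) = p * (1 + a₂) := by
          linear_combination (1 + (a₂ : ℚ)) * e2
        have e4 : (p : ℚ) * (1 + a₂) ≤ (a₂ - 1) * (2 * p + 1) := by nlinarith
        rw [← e3] at e4
        exact le_of_mul_le_mul_right e4 (by positivity)
      · have hm : (4 : ℚ) ≤ m₁ := by exact_mod_cast (by omega : 4 ≤ m₁)
        have h3 : (3 : ℚ) ≤ a₂ := by
          exact_mod_cast (by nlinarith : 3 ≤ a₂)
        have hY : 2 ≤ q * m₁ + k₁ := by nlinarith
        nlinarith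
    have := mul_le_mul_of_nonneg_left key (by linarith : 0 ≤ q)
    push_cast
    linarith

/-- The edge weight inside one gadget leaving a part of it is at least `1` (after division by the
weight of a side), if the part and its complement each contain a core or at least five half-edges.
The part has `a₁` half-edges on the large side, and `m₁` half-edges and `k₁` cores on the other
side; `a₂`, `m₂`, `k₂` count the complement. -/
theorem one_le_cross {p a₁ a₂ m₁ m₂ k₁ k₂ c : ℕ} {q : ℚ} (hp : 0 < p)
    (hq : q * (2 * p + 1) = p + 1)
    (ha : a₁ + a₂ = m₁ + m₂ + (2 * p + 1) * c) (hk : k₁ + k₂ = (p + 1) * c)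
    (h₁ : 1 ≤ k₁ ∨ 5 ≤ a₁ + m₁) (h₂ : 1 ≤ k₂ ∨ 5 ≤ a₂ + m₂) :
    q * a₁ + q * a₂ ≤ (q * a₁) * (q * m₂ + k₂) + (q * m₁ + k₁) * (q * a₂) := by
  by_cases hle : a₁ ≤ 1
  · exact one_le_cross_of_le_one hp hq ha hk h₁ hle
  by_cases hle' : a₂ ≤ 1
  · have := one_le_cross_of_le_one (a₁ := a₂) (a₂ := a₁) (m₁ := m₂) (m₂ := m₁) (k₁ := k₂)
      (k₂ := k₁) (c := c) hp hq (by omega) (by omega) h₂ hle'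
    linarith
  have hpQ : (1 : ℚ) ≤ p := by exact_mod_cast hp
  have hq1 : 1 / 2 ≤ q := by nlinarith
  have haQ : (a₁ : ℚ) + a₂ = m₁ + m₂ + (2 * p + 1) * c := by exact_mod_cast ha
  have hkQ : (k₁ : ℚ) + k₂ = (p + 1) * c := by exact_mod_cast hk
  have h1 : (2 : ℚ) ≤ a₁ := by exact_mod_cast (by omega : 2 ≤ a₁)
  have h2 : (2 : ℚ) ≤ a₂ := by exact_mod_cast (by omega : 2 ≤ a₂)
  have e1 : 1 ≤ q * a₁ := by nlinarith
  have e2 : 1 ≤ q * a₂ := by nlinarith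
  have := weight_le_cross (q := 1) (a₁ := q * a₁) (a₂ := q * a₂) (b₁ := q * m₁ + k₁)
    (b₂ := q * m₂ + k₂) (by positivity) (by positivity) (by positivity) (by positivity)
    (by linear_combination q * haQ - hkQ + (c : ℚ) * hq) (.inr e1) (.inr e2) (.inl e1) (.inl e2)
  linarith

/-! ### Half-edges and the edges split by a set -/

section

variable {V E : Type*}

/-- The other half-edge of the same edge. -/
def opp (h : E × Bool) : E × Bool := (h.1, !h.2)

@[simp] theorem opp_opp (h : E × Bool) : opp (opp h) = h := by simp [opp]

theorem opp_injective : Function.Injective (opp : E × Bool → E × Bool) :=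
  Function.LeftInverse.injective opp_opp

theorem opp_ne (h : E × Bool) : opp h ≠ h := by
  intro e
  have := congrArg Prod.snd e
  simp [opp] at this

/-- The half-edges in `P` whose other half is not in `P`. -/
noncomputable def exits [Fintype E] (P : E × Bool → Prop) : Finset (E × Bool) :=
  open Classical in univ.filter fun h => P h ∧ ¬ P (opp h)

/-- A set of half-edges has the parity of the number of edges it splits. -/
theorem exists_card_filter_eq_card_exits_add [Fintype E] (P : E × Bool → Prop) [DecidablePred P] :
    ∃ k, #{h | P h} = #(exits P) + 2 * k := by
  refine ⟨#{e : E | P (e, false) ∧ P (e, true)}, ?_⟩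
  simp only [exits, card_filter, Fintype.sum_prod_type, Fintype.sum_bool, mul_sum,
    ← sum_add_distrib]
  refine sum_congr rfl fun e _ => ?_
  by_cases h1 : P (e, false) <;> by_cases h2 : P (e, true) <;> simp [opp, h1, h2]

theorem card_edgeCut_eq_card_exits [DecidableEq V] [Fintype E] (G : HalfEdgeGraph V E)
    (X : Finset V) : #(G.edgeCut X) = #(exits fun h => G.inc h ∈ X) := by
  simp only [exits, edgeCut, card_filter, Fintype.sum_prod_type, Fintype.sum_bool]
  refine sum_congr rfl fun e _ => ?_
  by_cases h1 : G.inc (e, false) ∈ X <;> by_cases h2 : G.inc (e, true) ∈ X <;>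
    simp [opp, h1, h2]

/-! ### The gadget graph -/

/-- The vertices of the gadget graph: the half-edges, and `n v` additional vertices for each
vertex `v`, the *cores* of `v`. -/
abbrev GadgetVertex (E : Type*) {V : Type*} (n : V → ℕ) := (E × Bool) ⊕ (Σ v, Fin (n v))

variable (G : HalfEdgeGraph V E) (τ : E × Bool → ℤˣ) (n : V → ℕ)

/-- The vertex of `G` whose gadget contains `x`. -/
def gadgetLoc : GadgetVertex E n → V := Sum.elim G.inc Sigma.fst

/-- The side of the bipartition of its gadget on which `x` lies: a half-edge lies on the side given
by its sign, and the cores lie on the negative side. -/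
def gadgetSign : GadgetVertex E n → ℤˣ := Sum.elim τ fun _ => -1

/-- `x` and `y` are the two halves of one edge. -/
def IsEdgePair (x y : GadgetVertex E n) : Prop := ∃ h, x = .inl h ∧ y = .inl (opp h)

variable {n} in
theorem IsEdgePair.symm {x y : GadgetVertex E n} (h : IsEdgePair n x y) : IsEdgePair n y x := by
  obtain ⟨h, rfl, rfl⟩ := h
  exact ⟨opp h, rfl, by simp⟩

/-- The gadget graph: each vertex `v` of `G` is replaced by a complete bipartite graph between the
positive half-edges at `v` on one side and the negative half-edges and the cores of `v` on the
other, and the two halves of each edge are joined. -/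
def gadgetGraph : SimpleGraph (GadgetVertex E n) where
  Adj x y := (G.gadgetLoc n x = G.gadgetLoc n y ∧ gadgetSign τ n x ≠ gadgetSign τ n y) ∨
    IsEdgePair n x y
  symm := ⟨fun _ _ h => h.imp (fun h => ⟨h.1.symm, h.2.symm⟩) IsEdgePair.symm⟩
  loopless := ⟨by
    rintro x (h | ⟨h, rfl, h'⟩)
    · exact h.2 rfl
    · exact opp_ne h (Sum.inl_injective h').symm⟩

theorem units_cast_add_eq_zero {a b : ℤˣ} (h : a ≠ b) : (a : ℤ) + b = 0 := by
  rcases Int.units_eq_one_or a with rfl | rfl <;> rcases Int.units_eq_one_or b with rfl | rfl <;>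
    simp_all

/-- The edges whose two halves a perfect matching of the gadget graph does *not* pair up have
signed degree `n v` at `v`: inside the gadget of `v`, the matching pairs positive half-edges with
negative half-edges and with the `n v` cores. -/
theorem exists_finset_of_isPerfectMatching [DecidableEq V] [Fintype V] [Fintype E]
    [DecidableEq E] {M : (G.gadgetGraph τ n).Subgraph} (hM : M.IsPerfectMatching) :
    ∃ S : Finset E, ∀ v, ∑ h : E × Bool with G.inc h = v ∧ h.1 ∉ S, (τ h : ℤ) = n v := by
  classical
  rw [SimpleGraph.Subgraph.isPerfectMatching_iff] at hM
  choose mate hmate huniq using hM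
  have hadj : ∀ x y, M.Adj x y ↔ mate x = y :=
    fun x y => ⟨fun h => (huniq x y h).symm, fun h => h ▸ hmate x⟩
  have hinv : ∀ x, mate (mate x) = x := fun x => (hadj _ _).1 (hmate x).symm
  let S : Finset E := univ.filter fun e => M.Adj (.inl (e, false)) (.inl (e, true))
  have hS : ∀ h : E × Bool, h.1 ∈ S ↔ mate (.inl h) = .inl (opp h) := by
    rintro ⟨e, b⟩
    rw [← hadj]
    cases b
    · simp [S, opp]
    · simp [S, opp, M.adj_comm]
  refine ⟨S, fun v => ?_⟩
  let out : GadgetVertex E n → Prop := fun x => ∀ h, x = .inl h → h.1 ∉ S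
  have hpair : ∀ x, out x → ¬ IsEdgePair n x (mate x) := by
    rintro _ hx ⟨h, rfl, h'⟩
    exact hx h rfl ((hS h).2 h')
  have hout : ∀ x, out x → out (mate x) := by
    intro x hx h hh hmem
    rw [hS, ← hh, hinv] at hmem
    refine hx (opp h) hmem ?_
    rw [hS, ← hmem, hh, opp_opp]
  have hK : ∀ x, out x → G.gadgetLoc n x = G.gadgetLoc n (mate x) ∧
      gadgetSign τ n x ≠ gadgetSign τ n (mate x) := fun x hx =>
    (hmate x).adj_sub.resolve_right (hpair x hx)
  -- The matching is a sign-reversing involution on the vertices of the gadget that remain.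
  have h0 : ∑ x : GadgetVertex E n with G.gadgetLoc n x = v ∧ out x,
      (gadgetSign τ n x : ℤ) = 0 := by
    refine sum_involution (fun x _ => mate x) (fun x hx => ?_) (fun x hx _ h => ?_)
      (fun x hx => ?_) (fun x _ => hinv x)
    · exact units_cast_add_eq_zero (hK x (by simpa using (mem_filter.1 hx).2.2)).2
    · exact (hK x (mem_filter.1 hx).2.2).2 (congrArg _ h.symm)
    · obtain ⟨-, h1, h2⟩ := mem_filter.1 hx
      exact mem_filter.2 ⟨mem_univ _, (hK x h2).1.symm.trans h1, hout x h2⟩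
  have h1 : ∑ z : (Σ v, Fin (n v)), (if z.1 = v then (-1 : ℤ) else 0) = -n v := by
    rw [Fintype.sum_sigma, Fintype.sum_eq_single v fun u hu => by simp [hu]]
    simp
  rw [sum_filter, Fintype.sum_sum_type] at h0
  simp only [gadgetLoc, gadgetSign, Sum.elim_inl, Sum.elim_inr, out, reduceCtorEq,
    IsEmpty.forall_iff, implies_true, and_true, Sum.inl.injEq, forall_eq',
    Units.val_neg, Units.val_one, h1] at h0
  rw [sum_filter]
  linarith

end

/-! ### The fractional perfect matching -/

section

variable {V E : Type*} [DecidableEq V] [Fintype V] [Fintype E]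
variable (G : HalfEdgeGraph V E) (τ : E × Bool → ℤˣ) (n : V → ℕ)

open Classical in
/-- The number of half-edges at `v` of sign `s` in `C`. -/
noncomputable def halfCount (C : Finset (GadgetVertex E n)) (v : V) (s : ℤˣ) : ℕ :=
  #{h : E × Bool | .inl h ∈ C ∧ G.inc h = v ∧ τ h = s}

open Classical in
/-- The number of cores of `v` in `C`. -/
noncomputable def coreCount (C : Finset (GadgetVertex E n)) (v : V) : ℕ :=
  #{z : Σ v, Fin (n v) | .inr z ∈ C ∧ z.1 = v}

/-- The weight of a gadget vertex: `q` for a half-edge, `1` for a core. It is the total weight that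
the vertex receives from inside its gadget in `matchingWeight`. -/
def gadgetWeight (q : ℚ) : GadgetVertex E n → ℚ := Sum.elim (fun _ => q) fun _ => 1

open Classical in
/-- The total weight of `C` on side `s` of the gadget of `v`. -/
noncomputable def load (q : ℚ) (C : Finset (GadgetVertex E n)) (v : V) (s : ℤˣ) : ℚ :=
  ∑ x ∈ C with G.gadgetLoc n x = v ∧ gadgetSign τ n x = s, gadgetWeight n q x

open Classical in
/-- Edge weights on the gadget graph. Inside a gadget, the edge `xy` gets the product of the weights
of `x` and `y` divided by the weight of one side; the edge joining two halves of an edge of `G` gets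
`1 - q`. This is a fractional perfect matching if the two sides of every gadget have the same
weight. -/
noncomputable def matchingWeight (q : ℚ) (x y : GadgetVertex E n) : ℚ :=
  (if G.gadgetLoc n x = G.gadgetLoc n y ∧ gadgetSign τ n x ≠ gadgetSign τ n y then
    gadgetWeight n q x * gadgetWeight n q y / G.load τ n q univ (G.gadgetLoc n x) 1 else 0) +
  if IsEdgePair n x y then 1 - q else 0

omit [DecidableEq V] in
theorem sum_eq_sum_inl_add_sum_inr [DecidableEq (GadgetVertex E n)]
    (C : Finset (GadgetVertex E n)) (f : GadgetVertex E n → ℚ) :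
    ∑ x ∈ C, f x = ∑ h : E × Bool, (if .inl h ∈ C then f (.inl h) else 0) +
      ∑ z : (Σ v, Fin (n v)), if .inr z ∈ C then f (.inr z) else 0 := by
  classical
  rw [← Fintype.sum_sum_type (fun x => if x ∈ C then f x else 0)]
  simp

theorem load_one (q : ℚ) (C : Finset (GadgetVertex E n)) (v : V) :
    G.load τ n q C v 1 = q * G.halfCount τ n C v 1 := by
  classical
  rw [load, sum_filter, sum_eq_sum_inl_add_sum_inr, halfCount, card_filter, Nat.cast_sum, mul_sum]
  simp only [gadgetLoc, gadgetSign, gadgetWeight, Sum.elim_inl, Sum.elim_inr,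
    (by decide : ¬ (-1 : ℤˣ) = 1),
    and_false, if_false, ite_self, sum_const_zero, add_zero, Nat.cast_ite, Nat.cast_one, Nat.cast_zero,
    mul_ite, mul_one, mul_zero]
  refine sum_congr rfl fun h _ => ?_
  by_cases h1 : G.inc h = v <;> by_cases h2 : τ h = 1 <;> simp [h1, h2]

theorem load_neg_one (q : ℚ) (C : Finset (GadgetVertex E n)) (v : V) :
    G.load τ n q C v (-1) = q * G.halfCount τ n C v (-1) + coreCount n C v := by
  classical
  rw [load, sum_filter, sum_eq_sum_inl_add_sum_inr, halfCount, coreCount, card_filter, card_filter,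
    Nat.cast_sum, Nat.cast_sum, mul_sum]
  simp only [gadgetLoc, gadgetSign, gadgetWeight, Sum.elim_inl, Sum.elim_inr, and_true,
    Nat.cast_ite, Nat.cast_one, Nat.cast_zero, mul_ite, mul_one, mul_zero]
  congr 1
  · refine sum_congr rfl fun h _ => ?_
    by_cases h1 : G.inc h = v <;> by_cases h2 : τ h = -1 <;> simp [h1, h2]
  · refine sum_congr rfl fun z _ => ?_
    by_cases h1 : z.1 = v <;> simp [h1]

theorem halfCount_add_compl [DecidableEq (GadgetVertex E n)]
    (C : Finset (GadgetVertex E n)) (v : V) (s : ℤˣ) :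
    G.halfCount τ n C v s + G.halfCount τ n Cᶜ v s = #{h | G.inc h = v ∧ τ h = s} := by
  classical
  simp only [halfCount, card_filter, ← sum_add_distrib]
  refine sum_congr rfl fun h _ => ?_
  by_cases h1 : Sum.inl h ∈ C <;> simp [h1]

theorem coreCount_univ (v : V) : coreCount (E := E) n univ v = n v := by
  classical
  rw [coreCount, card_filter, Fintype.sum_sigma, Fintype.sum_eq_single v fun u hu => by simp [hu]]
  simp

theorem coreCount_add_compl [DecidableEq (GadgetVertex E n)]
    (C : Finset (GadgetVertex E n)) (v : V) :
    coreCount n C v + coreCount n Cᶜ v = n v := by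
  classical
  rw [← coreCount_univ (E := E) n v]
  simp only [coreCount, card_filter, ← sum_add_distrib]
  refine sum_congr rfl fun h _ => ?_
  by_cases h1 : Sum.inr h ∈ C <;> simp [h1]

omit [Fintype V] in
theorem card_halfEdges_eq (v : V) :
    #{h | G.inc h = v} = #{h | G.inc h = v ∧ τ h = 1} + #{h | G.inc h = v ∧ τ h = -1} := by
  simp only [card_filter, ← sum_add_distrib]
  refine sum_congr rfl fun h _ => ?_
  rcases Int.units_eq_one_or (τ h) with h1 | h1 <;> simp [h1]

omit [Fintype V] in
theorem sum_sign_eq (v : V) :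
    ∑ h with G.inc h = v, (τ h : ℤ) =
      #{h | G.inc h = v ∧ τ h = 1} - #{h | G.inc h = v ∧ τ h = -1} := by
  simp only [card_filter, sum_filter, Nat.cast_sum, ← sum_sub_distrib]
  refine sum_congr rfl fun h _ => ?_
  rcases Int.units_eq_one_or (τ h) with h1 | h1 <;> by_cases h2 : G.inc h = v <;> simp [h1, h2]

/-- The weight between two sets of gadget vertices, gadget by gadget. -/
theorem sum_matchingWeight [DecidableEq (GadgetVertex E n)] (q : ℚ)
    (C D : Finset (GadgetVertex E n)) :
    ∑ x ∈ C, ∑ y ∈ D, G.matchingWeight τ n q x y =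
      ∑ v, (G.load τ n q C v 1 * G.load τ n q D v (-1) +
        G.load τ n q C v (-1) * G.load τ n q D v 1) / G.load τ n q univ v 1 +
      (1 - q) * #{h : E × Bool | .inl h ∈ C ∧ .inl (opp h) ∈ D} := by
  classical
  simp only [matchingWeight, sum_add_distrib]
  congr 1
  · -- Sort the vertices of `C` by gadget and by side.
    rw [← sum_fiberwise C (G.gadgetLoc n)]
    refine sum_congr rfl fun v _ => ?_
    have hside : ∀ s : ℤˣ, ∑ x ∈ C with G.gadgetLoc n x = v ∧ gadgetSign τ n x = s,
        ∑ y ∈ D, (if G.gadgetLoc n x = G.gadgetLoc n y ∧ gadgetSign τ n x ≠ gadgetSign τ n y then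
          gadgetWeight n q x * gadgetWeight n q y / G.load τ n q univ (G.gadgetLoc n x) 1
          else 0) =
        G.load τ n q C v s * G.load τ n q D v (-s) / G.load τ n q univ v 1 := by
      intro s
      rw [load.eq_def (C := C), sum_mul, sum_div]
      refine sum_congr rfl fun x hx => ?_
      obtain ⟨-, rfl, rfl⟩ := mem_filter.1 hx
      rw [load.eq_def (C := D), mul_sum, sum_div, sum_filter]
      refine sum_congr rfl fun y _ => ?_
      refine if_congr ?_ rfl rfl
      rw [eq_comm (a := G.gadgetLoc n x)]
      refine and_congr_right fun _ => ?_
      rcases Int.units_eq_one_or (gadgetSign τ n x) with h1 | h1 <;>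
        rcases Int.units_eq_one_or (gadgetSign τ n y) with h2 | h2 <;> simp [h1, h2]
    have h1 := hside 1
    have h2 := hside (-1)
    rw [neg_neg] at h2
    rw [add_div, ← h1, ← h2]
    rw [← sum_filter_add_sum_filter_not _ (fun x => gadgetSign τ n x = 1), filter_filter,
      filter_filter]
    congr 1
    refine sum_congr (filter_congr fun x _ => and_congr_right fun _ => ?_) fun _ _ => rfl
    exact ⟨(Int.units_eq_one_or _).resolve_left, fun h h' => by simp [h] at h'⟩
  · rw [sum_eq_sum_inl_add_sum_inr]
    have h2 : ∀ z : (Σ v, Fin (n v)), ∀ y : GadgetVertex E n, ¬ IsEdgePair n (.inr z) y := by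
      rintro z y ⟨h, h', -⟩
      cases h'
    have h1 : ∀ h : E × Bool, ∀ y : GadgetVertex E n,
        IsEdgePair n (.inl h) y ↔ .inl (opp h) = y := by
      refine fun h y => ⟨?_, fun e => ⟨h, rfl, e.symm⟩⟩
      rintro ⟨h', e, rfl⟩
      cases e
      rfl
    simp only [h1, h2, if_false, sum_const_zero, ite_self, add_zero, sum_ite_eq, card_filter,
      Nat.cast_sum, mul_sum, ← ite_and]
    refine sum_congr rfl fun h _ => ?_
    split_ifs <;> simp

end

/-! ### Weight and parity of a set of gadget vertices -/

section

variable {V E : Type*} [DecidableEq V] [Fintype V] [Fintype E]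
variable {G : HalfEdgeGraph V E} {τ : E × Bool → ℤˣ} {n c : V → ℕ} {p : ℕ} {q : ℚ}

omit [DecidableEq V] [Fintype V] [Fintype E] in
theorem gadgetWeight_mem (hq0 : 0 ≤ q) (hq1 : q ≤ 1) (x : GadgetVertex E n) :
    q ≤ gadgetWeight n q x ∧ 0 ≤ gadgetWeight n q x := by
  rcases x with h | z <;> simp [gadgetWeight, *]

omit [Fintype V] [Fintype E] in
theorem load_nonneg (hq0 : 0 ≤ q) (C : Finset (GadgetVertex E n)) (v : V) (s : ℤˣ) :
    0 ≤ G.load τ n q C v s := by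
  refine sum_nonneg fun x _ => ?_
  rcases x with h | z <;> simp [gadgetWeight, *]

omit [Fintype V] [Fintype E] in
theorem le_load (hq0 : 0 ≤ q) (hq1 : q ≤ 1) {C : Finset (GadgetVertex E n)}
    {x : GadgetVertex E n} (hx : x ∈ C) :
    q ≤ G.load τ n q C (G.gadgetLoc n x) (gadgetSign τ n x) := by
  refine (gadgetWeight_mem hq0 hq1 x).1.trans (single_le_sum (f := gadgetWeight n q)
    (fun y _ => (gadgetWeight_mem hq0 hq1 y).2) ?_)
  simp [hx]

theorem load_add_compl [DecidableEq (GadgetVertex E n)] (C : Finset (GadgetVertex E n))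
    (v : V) (s : ℤˣ) :
    G.load τ n q C v s + G.load τ n q Cᶜ v s = G.load τ n q univ v s := by
  classical
  simp only [load, sum_filter]
  exact sum_add_sum_compl C _

omit [Fintype V] in
theorem card_pos_eq_add (hc : ∀ v, ∑ h with G.inc h = v, (τ h : ℤ) = (2 * p + 1) * c v) (v : V) :
    #{h | G.inc h = v ∧ τ h = 1} = #{h | G.inc h = v ∧ τ h = -1} + (2 * p + 1) * c v := by
  have h1 := hc v
  rw [sum_sign_eq] at h1
  zify
  linarith

/-- The two sides of a gadget have the same weight. This is what determines the value of `q`. -/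
theorem load_univ_balanced (hq : q * (2 * p + 1) = p + 1) (hn : ∀ v, n v = (p + 1) * c v)
    (hc : ∀ v, ∑ h with G.inc h = v, (τ h : ℤ) = (2 * p + 1) * c v) (v : V) :
    G.load τ n q univ v 1 = G.load τ n q univ v (-1) := by
  have h1 := card_pos_eq_add hc v
  rw [load_one, load_neg_one, coreCount_univ, hn]
  simp only [halfCount, mem_univ, true_and, h1]
  push_cast
  linear_combination (c v : ℚ) * hq

/-- The weight of the edges inside the gadget of `v` leaving `C`. -/
noncomputable def gadgetCut (G : HalfEdgeGraph V E) (τ : E × Bool → ℤˣ) (n : V → ℕ) (q : ℚ)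
    [DecidableEq (GadgetVertex E n)] (C : Finset (GadgetVertex E n)) (v : V) : ℚ :=
  (G.load τ n q C v 1 * G.load τ n q Cᶜ v (-1) +
    G.load τ n q C v (-1) * G.load τ n q Cᶜ v 1) / G.load τ n q univ v 1

theorem gadgetCut_nonneg [DecidableEq (GadgetVertex E n)] (hq0 : 0 ≤ q)
    (C : Finset (GadgetVertex E n)) (v : V) : 0 ≤ G.gadgetCut τ n q C v :=
  div_nonneg (add_nonneg (mul_nonneg (load_nonneg hq0 _ _ _) (load_nonneg hq0 _ _ _))
    (mul_nonneg (load_nonneg hq0 _ _ _) (load_nonneg hq0 _ _ _))) (load_nonneg hq0 _ _ _)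

/-- The set `C` splits the gadget of `v`: it contains some but not all of its vertices. -/
def Splits (G : HalfEdgeGraph V E) (n : V → ℕ) (C : Finset (GadgetVertex E n)) (v : V) : Prop :=
  (∃ x ∈ C, G.gadgetLoc n x = v) ∧ ∃ y ∉ C, G.gadgetLoc n y = v

theorem load_univ_pos (hq0 : 0 < q) (hq1 : q ≤ 1)
    (hbal : ∀ v, G.load τ n q univ v 1 = G.load τ n q univ v (-1)) (x : GadgetVertex E n) :
    0 < G.load τ n q univ (G.gadgetLoc n x) 1 := by
  have := hq0.trans_le (le_load (τ := τ) (G := G) hq0.le hq1 (mem_univ x))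
  rcases Int.units_eq_one_or (gadgetSign τ n x) with h | h
  · rwa [h] at this
  · rwa [h, ← hbal] at this

theorem le_gadgetCut [DecidableEq (GadgetVertex E n)] (hq0 : 0 < q) (hq1 : q ≤ 1)
    (hbal : ∀ v, G.load τ n q univ v 1 = G.load τ n q univ v (-1))
    {C : Finset (GadgetVertex E n)} {v : V} (hv : G.Splits n C v) :
    q ≤ G.gadgetCut τ n q C v := by
  obtain ⟨⟨x, hx, rfl⟩, y, hy, hyx⟩ := hv
  rw [gadgetCut, le_div_iff₀ (load_univ_pos hq0 hq1 hbal x), ← load_add_compl C]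
  have hx' := le_load (τ := τ) (G := G) hq0.le hq1 hx
  have hy' := le_load (τ := τ) (G := G) hq0.le hq1 (mem_compl.2 hy)
  rw [hyx] at hy'
  -- The positive side consists of half-edges only, so its load is a multiple of `q`.
  have hint : ∀ D : Finset (GadgetVertex E n), G.load τ n q D (G.gadgetLoc n x) 1 = 0 ∨
      q ≤ G.load τ n q D (G.gadgetLoc n x) 1 := by
    intro D
    rw [load_one]
    rcases Nat.eq_zero_or_pos (G.halfCount τ n D (G.gadgetLoc n x) 1) with h | h
    · simp [h]
    · exact .inr (le_mul_of_one_le_right hq0.le (by exact_mod_cast h))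
  have hor : ∀ {s : ℤˣ} {D : Finset (GadgetVertex E n)},
      q ≤ G.load τ n q D (G.gadgetLoc n x) s →
      q ≤ G.load τ n q D (G.gadgetLoc n x) 1 ∨ q ≤ G.load τ n q D (G.gadgetLoc n x) (-1) := by
    intro s D h
    rcases Int.units_eq_one_or s with rfl | rfl
    · exact .inl h
    · exact .inr h
  refine weight_le_cross (load_nonneg hq0.le _ _ _) (load_nonneg hq0.le _ _ _)
    (load_nonneg hq0.le _ _ _) (load_nonneg hq0.le _ _ _) ?_ (hint _) (hint _) (hor hx') (hor hy')
  rw [load_add_compl, load_add_compl, hbal]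

theorem one_le_gadgetCut [DecidableEq (GadgetVertex E n)] (hp : 0 < p)
    (hq : q * (2 * p + 1) = p + 1) (hn : ∀ v, n v = (p + 1) * c v)
    (hc : ∀ v, ∑ h with G.inc h = v, (τ h : ℤ) = (2 * p + 1) * c v)
    {C : Finset (GadgetVertex E n)} {v : V} (hT : 0 < G.load τ n q univ v 1)
    (h₁ : 1 ≤ coreCount n C v ∨ 5 ≤ G.halfCount τ n C v 1 + G.halfCount τ n C v (-1))
    (h₂ : 1 ≤ coreCount n Cᶜ v ∨ 5 ≤ G.halfCount τ n Cᶜ v 1 + G.halfCount τ n Cᶜ v (-1)) :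
    1 ≤ G.gadgetCut τ n q C v := by
  rw [gadgetCut, le_div_iff₀ hT, one_mul, ← load_add_compl C]
  simp only [load_one, load_neg_one]
  refine one_le_cross hp hq ?_ ?_ h₁ h₂ (c := c v)
  · rw [halfCount_add_compl, card_pos_eq_add hc, ← halfCount_add_compl G τ n C]
  · rw [coreCount_add_compl, hn]

/-- Parity of a set `C` of gadget vertices that contains the whole gadgets of the vertices in
`X`. Since `c v` has the parity of the degree of `v`, the cores of the vertices in `X` contribute
`p + 1` times the size of the edge cut of `X`. -/
theorem card_mod_two (hn : ∀ v, n v = (p + 1) * c v)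
    (hc : ∀ v, ∑ h with G.inc h = v, (τ h : ℤ) = (2 * p + 1) * c v)
    (C : Finset (GadgetVertex E n)) (X : Finset V)
    (hX : ∀ x, G.gadgetLoc n x ∈ X → x ∈ C) :
    #C % 2 = (#(exits fun h => .inl h ∈ C) + (p + 1) * #(G.edgeCut X) +
      ∑ v ∈ Xᶜ, coreCount n C v) % 2 := by
  classical
  have h1 : #C = #{h : E × Bool | .inl h ∈ C} + ∑ v, coreCount n C v := by
    have e1 : ∑ v, coreCount n C v = #{z : Σ v, Fin (n v) | .inr z ∈ C} := by
      rw [card_eq_sum_card_fiberwise (f := Sigma.fst) (t := univ) fun _ _ => mem_univ _]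
      simp only [coreCount, filter_filter]
    rw [e1, ← card_toLeft_add_card_toRight (u := C)]
    congr 2 <;> ext <;> simp
  obtain ⟨k₂, h2⟩ := exists_card_filter_eq_card_exits_add
    fun h : E × Bool => (.inl h : GadgetVertex E n) ∈ C
  have h3 : ∑ v, coreCount n C v = (p + 1) * ∑ v ∈ X, c v + ∑ v ∈ Xᶜ, coreCount n C v := by
    rw [← sum_add_sum_compl X, mul_sum]
    congr 1
    refine sum_congr rfl fun v hv => ?_
    rw [← hn, ← coreCount_univ (E := E) n v]
    simp only [coreCount, mem_univ, true_and]
    congr 1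
    ext z
    simp only [mem_filter, mem_univ, true_and, and_iff_right_iff_imp]
    rintro rfl
    exact hX _ hv
  obtain ⟨k₄, h4⟩ := exists_card_filter_eq_card_exits_add fun h : E × Bool => G.inc h ∈ X
  have h5 : #{h | G.inc h ∈ X} =
      ∑ v ∈ X, c v + 2 * (∑ v ∈ X, #{h | G.inc h = v ∧ τ h = -1} + p * ∑ v ∈ X, c v) := by
    have e1 : #{h | G.inc h ∈ X} = ∑ v ∈ X, #{h | G.inc h = v} := by
      rw [card_eq_sum_card_fiberwise (f := G.inc) (t := X) fun h hh => by simpa using hh]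
      refine sum_congr rfl fun v hv => ?_
      rw [filter_filter]
      congr 1
      ext h
      simp only [mem_filter, mem_univ, true_and, and_iff_right_iff_imp]
      rintro rfl
      exact hv
    rw [e1, mul_sum, ← sum_add_distrib, mul_sum, ← sum_add_distrib]
    refine sum_congr rfl fun v _ => ?_
    rw [card_halfEdges_eq G τ, card_pos_eq_add hc]
    ring
  rw [card_edgeCut_eq_card_exits, h1, h2, h3]
  have h6 : (∑ v ∈ X, c v) % 2 = #(exits fun h => G.inc h ∈ X) % 2 := by omega
  have h7 : ((p + 1) * ∑ v ∈ X, c v) % 2 = ((p + 1) * #(exits fun h => G.inc h ∈ X)) % 2 := by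
    rw [Nat.mul_mod, h6, ← Nat.mul_mod]
  omega

end

/-! ### Odd sets of gadget vertices -/

section

variable {V E : Type*} [DecidableEq V] [Fintype V] [Fintype E]
variable {G : HalfEdgeGraph V E} {τ : E × Bool → ℤˣ} {n c : V → ℕ} {p : ℕ} {q : ℚ}

omit [Fintype V] in
theorem OddEdgeConnected.le_card_edgeCut (hG : G.OddEdgeConnected (2 * p + 1)) {X : Finset V}
    (hX : Odd #(G.edgeCut X)) : 2 * p + 1 ≤ #(G.edgeCut X) := by
  by_contra hlt
  refine hG _ ?_ (G.edgeCut X) ⟨rfl, hX, X, rfl⟩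
  obtain ⟨k, hk⟩ := hX
  omega

omit [DecidableEq V] [Fintype V] in
theorem exits_eq_empty {P : E × Bool → Prop} : exits P = ∅ ↔ ∀ h, P h → P (opp h) := by
  simp [exits, filter_eq_empty_iff]

omit [Fintype E] in
theorem coreCount_eq_zero {C : Finset (GadgetVertex E n)} {v : V}
    (h : ∀ x ∈ C, G.gadgetLoc n x ≠ v) : coreCount n C v = 0 := by
  classical
  rw [coreCount, card_eq_zero, filter_eq_empty_iff]
  exact fun z _ hz => h _ hz.1 hz.2

theorem even_card_gadgetVertex (hn : ∀ v, n v = (p + 1) * c v)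
    (hc : ∀ v, ∑ h with G.inc h = v, (τ h : ℤ) = (2 * p + 1) * c v) :
    Even (Fintype.card (GadgetVertex E n)) := by
  have h := card_mod_two hn hc (univ : Finset (GadgetVertex E n)) univ (by simp)
  have h1 : exits (fun h : E × Bool => (.inl h : GadgetVertex E n) ∈ univ) = ∅ :=
    exits_eq_empty.2 (by simp)
  have h2 : G.edgeCut univ = ∅ := by simp [edgeCut]
  rw [h1, h2] at h
  rw [Nat.even_iff, ← card_univ, h]
  simp

/-- Let `C` be an odd set that splits no edge and at most the gadget of `v`. If it contains no core of
`v`, then the vertices other than `v` whose gadgets it contains have an odd edge cut and `p` is even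
by parity, and all edges of this cut end at `v`; their number is at least `2 * p + 1 ≥ 5`. -/
theorem one_le_coreCount_or_five_le (hp : 0 < p) (hG : G.OddEdgeConnected (2 * p + 1))
    (hn : ∀ v, n v = (p + 1) * c v)
    (hc : ∀ v, ∑ h with G.inc h = v, (τ h : ℤ) = (2 * p + 1) * c v)
    {C : Finset (GadgetVertex E n)} (hC : Odd #C) {v : V}
    (hsplit : ∀ u, u ≠ v → ¬ G.Splits n C u)
    (hclosed : ∀ h : E × Bool, .inl h ∈ C → .inl (opp h) ∈ C) :
    1 ≤ coreCount n C v ∨ 5 ≤ G.halfCount τ n C v 1 + G.halfCount τ n C v (-1) := by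
  classical
  rw [or_iff_not_imp_left]
  intro hk
  have hk : coreCount n C v = 0 := by omega
  let X : Finset V := univ.filter fun u => u ≠ v ∧ ∃ x ∈ C, G.gadgetLoc n x = u
  have hmem : ∀ x, G.gadgetLoc n x ≠ v → (G.gadgetLoc n x ∈ X ↔ x ∈ C) := by
    intro x hx
    simp only [X, mem_filter, mem_univ, true_and]
    refine ⟨fun ⟨_, h⟩ => ?_, fun h => ⟨hx, x, h, rfl⟩⟩
    by_contra hxC
    exact hsplit _ hx ⟨h, x, hxC, rfl⟩
  have hvX : v ∉ X := by simp [X]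
  have hpar := card_mod_two hn hc C X fun x hx =>
    (hmem x fun h => hvX (h ▸ hx)).1 hx
  have hcore : ∑ u ∈ Xᶜ, coreCount n C u = 0 := by
    refine sum_eq_zero fun u hu => ?_
    by_cases huv : u = v
    · rw [huv, hk]
    · refine coreCount_eq_zero (G := G) fun x hx hxu => ?_
      subst hxu
      exact mem_compl.1 hu ((hmem x huv).2 hx)
  rw [hcore, exits_eq_empty.2 hclosed, card_empty, zero_add, add_zero, Nat.odd_iff.1 hC] at hpar
  have hodd : Odd ((p + 1) * #(G.edgeCut X)) := Nat.odd_iff.2 hpar.symm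
  rw [Nat.odd_mul] at hodd
  have hcut := hG.le_card_edgeCut hodd.2
  have hle : #(G.edgeCut X) ≤ G.halfCount τ n C v 1 + G.halfCount τ n C v (-1) := by
    have hsum : G.halfCount τ n C v 1 + G.halfCount τ n C v (-1) =
        #{h : E × Bool | (.inl h : GadgetVertex E n) ∈ C ∧ G.inc h = v} := by
      simp only [halfCount, card_filter, ← sum_add_distrib]
      refine sum_congr rfl fun h _ => ?_
      rcases Int.units_eq_one_or (τ h) with h1 | h1 <;> simp [h1]
    rw [hsum, card_edgeCut_eq_card_exits]
    refine card_le_card_of_injOn opp (fun h hh => ?_) opp_injective.injOn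
    simp only [exits, coe_filter, mem_univ, true_and, Set.mem_ofPred_eq] at hh ⊢
    have hC' : .inl (opp h) ∈ C :=
      hclosed h ((hmem (.inl h) fun h' => hvX (h' ▸ hh.1)).1 hh.1)
    refine ⟨hC', ?_⟩
    by_contra hne
    exact hh.2 ((hmem (.inl (opp h)) hne).2 hC')
  obtain ⟨k, hk⟩ := hodd.1
  omega

/-- Every odd set `C` of gadget vertices has at least the weight `1` leaving it. A split gadget
contributes at least `q > 1/2` and a split edge contributes `1 - q ≥ 1/3`, so only two cases are not
immediate: only edges are split, at most two of them, or only one gadget is split. The first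
is excluded by odd-edge-connectivity, the second is `one_le_gadgetCut`. -/
theorem one_le_sum_matchingWeight [DecidableEq (GadgetVertex E n)] (hp : 0 < p)
    (hG : G.OddEdgeConnected (2 * p + 1)) (hq : q * (2 * p + 1) = p + 1)
    (hn : ∀ v, n v = (p + 1) * c v)
    (hc : ∀ v, ∑ h with G.inc h = v, (τ h : ℤ) = (2 * p + 1) * c v)
    {C : Finset (GadgetVertex E n)} (hC : Odd #C) :
    1 ≤ ∑ x ∈ C, ∑ y ∈ Cᶜ, G.matchingWeight τ n q x y := by
  classical
  have hpQ : (1 : ℚ) ≤ p := by exact_mod_cast hp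
  have hq0 : 1 / 2 ≤ q := by nlinarith
  have hq1 : q ≤ 1 := by nlinarith
  have hq3 : 3 * q ≤ 2 := by nlinarith
  have hbal := load_univ_balanced hq hn hc
  rw [sum_matchingWeight]
  have hex : #{h : E × Bool | (.inl h : GadgetVertex E n) ∈ C ∧ .inl (opp h) ∈ Cᶜ} =
      #(exits fun h => (.inl h : GadgetVertex E n) ∈ C) := by
    simp [exits]
  rw [hex]
  change 1 ≤ ∑ v, G.gadgetCut τ n q C v + _
  have hg0 : ∀ v ∈ univ, 0 ≤ G.gadgetCut τ n q C v := fun v _ => gadgetCut_nonneg (by linarith) C v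
  have hg : ∀ v, G.Splits n C v → q ≤ G.gadgetCut τ n q C v := fun v hv =>
    le_gadgetCut (by linarith) hq1 hbal hv
  set t := #(exits fun h => (.inl h : GadgetVertex E n) ∈ C) with ht
  have hsum0 : 0 ≤ ∑ v, G.gadgetCut τ n q C v := sum_nonneg hg0
  have htQ : (0 : ℚ) ≤ t := Nat.cast_nonneg _
  by_cases h3 : 3 ≤ t
  · have : (3 : ℚ) ≤ t := by exact_mod_cast h3
    nlinarith
  -- From here on at most two edges are split.
  by_cases hnone : ∀ v, ¬ G.Splits n C v
  · let X : Finset V := univ.filter fun u => ∃ x ∈ C, G.gadgetLoc n x = u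
    have hmem : ∀ x, G.gadgetLoc n x ∈ X ↔ x ∈ C := by
      intro x
      simp only [X, mem_filter, mem_univ, true_and]
      refine ⟨fun h => ?_, fun h => ⟨x, h, rfl⟩⟩
      by_contra hxC
      exact hnone _ ⟨h, x, hxC, rfl⟩
    have hpar := card_mod_two hn hc C X fun x hx => (hmem x).1 hx
    have hcore : ∑ u ∈ Xᶜ, coreCount n C u = 0 := by
      refine sum_eq_zero fun u hu => ?_
      refine coreCount_eq_zero (G := G) fun x hx hxu => ?_
      subst hxu
      exact mem_compl.1 hu ((hmem x).2 hx)
    have hcut : #(G.edgeCut X) = t := by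
      rw [card_edgeCut_eq_card_exits, ht]
      congr 2
      ext h
      exact hmem (.inl h)
    rw [hcore, ← ht, hcut, add_zero, Nat.odd_iff.1 hC] at hpar
    have hodd : Odd ((p + 2) * t) := Nat.odd_iff.2 (by rw [hpar]; ring_nf)
    have := hG.le_card_edgeCut (X := X) (by rw [hcut]; exact (Nat.odd_mul.1 hodd).2)
    omega
  · push Not at hnone
    obtain ⟨v, hv⟩ := hnone
    by_cases htwo : ∃ u, u ≠ v ∧ G.Splits n C u
    · obtain ⟨u, huv, hu⟩ := htwo
      have h2 := sum_le_sum_of_subset_of_nonneg (f := fun v => G.gadgetCut τ n q C v)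
        (subset_univ {u, v}) fun v hv _ => hg0 v hv
      rw [sum_pair huv] at h2
      have e1 := hg u hu
      have e2 := hg v hv
      nlinarith
    · have hone : G.gadgetCut τ n q C v ≤ ∑ v, G.gadgetCut τ n q C v :=
        single_le_sum (f := fun v => G.gadgetCut τ n q C v) hg0 (mem_univ v)
      by_cases ht0 : t = 0
      · push Not at htwo
        have hclosed := exits_eq_empty.1 (card_eq_zero.1 ht0)
        -- The complement of `C` satisfies the same assumptions.
        have h1 : 1 ≤ G.gadgetCut τ n q C v := by
          refine one_le_gadgetCut hp hq hn hc ?_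
            (one_le_coreCount_or_five_le hp hG hn hc hC htwo hclosed)
            (one_le_coreCount_or_five_le hp hG hn hc ?_ (fun u hu => ?_) fun h hh => ?_)
          · obtain ⟨⟨x, -, rfl⟩, -⟩ := hv
            exact load_univ_pos (by linarith) hq1 hbal x
          · have he := even_card_gadgetVertex hn hc
            rw [card_compl]
            exact Nat.Even.sub_odd (card_le_univ C) he hC
          · rintro ⟨⟨x, hx, hxu⟩, y, hy, hyu⟩
            exact htwo u hu ⟨⟨y, by simpa using hy, hyu⟩, x, mem_compl.1 hx, hxu⟩
          · rw [mem_compl] at hh ⊢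
            intro h'
            have := hclosed _ h'
            rw [opp_opp] at this
            exact hh this
        nlinarith
      · have e1 := hg v hv
        have : (1 : ℚ) ≤ t := by exact_mod_cast Nat.one_le_iff_ne_zero.2 ht0
        nlinarith

theorem sum_matchingWeight_le_one [DecidableEq (GadgetVertex E n)] (hq0 : 0 ≤ q)
    (hbal : ∀ v, G.load τ n q univ v 1 = G.load τ n q univ v (-1))
    (y : GadgetVertex E n) : ∑ x, G.matchingWeight τ n q x y ≤ 1 := by
  classical
  have h := sum_matchingWeight G τ n q univ {y}
  simp only [sum_singleton] at h
  have hload : ∀ v s, G.load τ n q {y} v s =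
      if G.gadgetLoc n y = v ∧ gadgetSign τ n y = s then gadgetWeight n q y else 0 := by
    intro v s
    rw [load, sum_filter, sum_singleton]
  have hle : ∑ v, (G.load τ n q univ v 1 * G.load τ n q {y} v (-1) +
      G.load τ n q univ v (-1) * G.load τ n q {y} v 1) / G.load τ n q univ v 1 ≤
      ∑ v, (G.load τ n q {y} v (-1) + G.load τ n q {y} v 1) := by
    refine sum_le_sum fun v _ => ?_
    rw [← hbal v, ← mul_add, mul_div_assoc, mul_div_left_comm]
    exact mul_le_of_le_one_right (add_nonneg (load_nonneg hq0 _ _ _) (load_nonneg hq0 _ _ _))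
      (div_self_le_one _)
  have hsum : ∑ v, (G.load τ n q {y} v (-1) + G.load τ n q {y} v 1) = gadgetWeight n q y := by
    simp only [hload]
    rw [Fintype.sum_eq_single (G.gadgetLoc n y) fun v hv => by simp [hv.symm]]
    rcases Int.units_eq_one_or (gadgetSign τ n y) with h1 | h1 <;> simp [h1]
  rw [h]
  refine (add_le_add_left (hle.trans_eq hsum) _).trans ?_
  rcases y with h₀ | z
  · have : #{x : E × Bool | (.inl x : GadgetVertex E n) ∈ univ ∧
        (.inl (opp x) : GadgetVertex E n) ∈ ({.inl h₀} : Finset (GadgetVertex E n))} = 1 := by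
      rw [card_eq_one]
      refine ⟨opp h₀, ?_⟩
      ext x
      simp only [mem_univ, mem_singleton, Sum.inl.injEq, true_and, mem_filter]
      exact ⟨fun e => by rw [← e, opp_opp], fun e => by rw [e, opp_opp]⟩
    rw [this]
    simp [gadgetWeight]
  · simp [gadgetWeight]

/-- If the signed degrees are `(2 * p + 1) * c v`, then some set of edges, given here as the complement
of `S`, has the signed degrees `(p + 1) * c v`. -/
theorem exists_finset_sum_sign_eq [DecidableEq E] (hp : 0 < p) (hG : G.OddEdgeConnected (2 * p + 1))
    (hc : ∀ v, ∑ h with G.inc h = v, (τ h : ℤ) = (2 * p + 1) * c v) :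
    ∃ S : Finset E, ∀ v,
      ∑ h : E × Bool with G.inc h = v ∧ h.1 ∉ S, (τ h : ℤ) = (p + 1) * c v := by
  classical
  let n : V → ℕ := fun v => (p + 1) * c v
  let q : ℚ := (p + 1) / (2 * p + 1)
  have hq : q * (2 * p + 1) = p + 1 := div_mul_cancel₀ _ (by positivity)
  have hq0 : 0 ≤ q := by positivity
  have hq1 : q ≤ 1 := by
    have : (1 : ℚ) ≤ p := by exact_mod_cast hp
    nlinarith
  have hn : ∀ v, n v = (p + 1) * c v := fun _ => rfl
  obtain ⟨M, hM⟩ := (G.gadgetGraph τ n).exists_isPerfectMatching_of_weight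
    (G.matchingWeight τ n q)
    (fun x y => by
      have := gadgetWeight_mem hq0 hq1 x
      have := gadgetWeight_mem hq0 hq1 y
      refine add_nonneg ?_ ?_ <;> split_ifs
      · exact div_nonneg (mul_nonneg (by tauto) (by tauto)) (load_nonneg hq0 _ _ _)
      all_goals linarith)
    (fun x y hxy => by
      contrapose! hxy
      obtain ⟨h1, h2⟩ := not_or.1 hxy
      rw [matchingWeight, if_neg h1, if_neg h2, add_zero])
    (sum_matchingWeight_le_one hq0 (load_univ_balanced hq hn hc))
    (fun C hC => one_le_sum_matchingWeight hp hG hq hn hc hC)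
  obtain ⟨S, hS⟩ := exists_finset_of_isPerfectMatching G τ n hM
  exact ⟨S, fun v => by rw [hS]; push_cast [hn]; rfl⟩

end

/-! ### Orientations from modulo flows -/

section

variable {V E : Type*} [DecidableEq V] [Fintype E]
variable {G : HalfEdgeGraph V E} {τ : E × Bool → ℤˣ} {p : ℕ}

/-- The version of `exists_finset_sum_sign_eq` for `c` with integer values: reverse the signs of all
half-edges at the vertices with `c v < 0`. -/
theorem exists_finset_sum_sign_eq_of_int [Fintype V] [DecidableEq E] {c : V → ℤ} (hp : 0 < p)
    (hG : G.OddEdgeConnected (2 * p + 1))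
    (hc : ∀ v, ∑ h with G.inc h = v, (τ h : ℤ) = (2 * p + 1) * c v) :
    ∃ S : Finset E, ∀ v,
      ∑ h : E × Bool with G.inc h = v ∧ h.1 ∉ S, (τ h : ℤ) = (p + 1) * c v := by
  let ε : V → ℤˣ := fun v => if 0 ≤ c v then 1 else -1
  have hε : ∀ v, (ε v : ℤ) * c v = (c v).natAbs := by
    intro v
    by_cases h : 0 ≤ c v
    · simp [ε, h, abs_of_nonneg]
    · simp [ε, h, abs_of_neg (not_le.1 h)]
  have hε2 : ∀ v, (ε v : ℤ) * ε v = 1 := fun v => by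
    rw [← Units.val_mul, Int.units_mul_self, Units.val_one]
  obtain ⟨S, hS⟩ := exists_finset_sum_sign_eq (τ := fun h => ε (G.inc h) * τ h)
    (c := fun v => (c v).natAbs) hp hG fun v => by
      rw [← hε, mul_left_comm, ← hc, mul_sum]
      refine sum_congr rfl fun h hh => ?_
      rw [(mem_filter.1 hh).2, Units.val_mul]
  refine ⟨S, fun v => ?_⟩
  have h1 : (ε v : ℤ) * ∑ h : E × Bool with G.inc h = v ∧ h.1 ∉ S, (τ h : ℤ) =
      ε v * ((p + 1) * c v) := by
    rw [mul_left_comm, hε, ← hS v, mul_sum]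
    refine sum_congr rfl fun h hh => ?_
    rw [(mem_filter.1 hh).2.1, Units.val_mul]
  have h2 := congrArg (fun z => (ε v : ℤ) * z) h1
  simpa only [← mul_assoc, hε2, one_mul] using h2

/-- A modulo circular flow can be made congruent to the constant `p` by reversing edges, because
`p + 1 ≡ -p` modulo `2 * p + 1`. As `p` is invertible, the signed degrees vanish modulo
`2 * p + 1`. -/
theorem AdmitsModuloCircularFlow.exists_orientation {σ : E → ℤˣ}
    (h : G.AdmitsModuloCircularFlow σ (2 * p + 1) p) :
    ∃ τ, G.IsOrientation σ τ ∧ ∀ v, (2 * p + 1 : ℤ) ∣ ∑ h with G.inc h = v, (τ h : ℤ) := by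
  obtain ⟨τ, hτ, f, hf, hbd⟩ := h
  have hs : ∀ e, ∃ s : ℤˣ, (2 * p + 1 : ℤ) ∣ f e - p * s := by
    intro e
    obtain ⟨h1, h2⟩ := hf e
    push_cast at h2
    rcases abs_cases (f e) with ⟨h3, h4⟩ | ⟨h3, h4⟩
    · obtain h5 | h5 : f e = p ∨ f e = p + 1 := by omega
      · exact ⟨1, by simp [h5]⟩
      · exact ⟨-1, ⟨1, by rw [h5]; push_cast; ring⟩⟩
    · obtain h5 | h5 : f e = -p ∨ f e = -(p + 1) := by omega
      · exact ⟨-1, by simp [h5]⟩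
      · exact ⟨1, ⟨-1, by rw [h5]; push_cast; ring⟩⟩
  choose s hs using hs
  refine ⟨fun h => s h.1 * τ h, fun e => ?_, fun v => ?_⟩
  · rw [mul_mul_mul_comm, Int.units_mul_self, one_mul, hτ e]
  · have h1 : (2 * p + 1 : ℤ) ∣ G.boundary τ f v := by
      have := (Int.modEq_zero_iff_dvd.1 (hbd v))
      exact_mod_cast this
    have h2 : (2 * p + 1 : ℤ) ∣ G.boundary τ f v -
        p * ∑ h with G.inc h = v, ((s h.1 * τ h : ℤˣ) : ℤ) := by
      rw [boundary, mul_sum, ← sum_sub_distrib]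
      refine dvd_sum fun h _ => ?_
      have := (hs h.1).mul_right (τ h : ℤ)
      rwa [sub_mul, mul_assoc, ← Units.val_mul] at this
    have h3 := (dvd_sub_right h1).1 h2
    refine IsCoprime.dvd_of_dvd_mul_left ?_ h3
    exact ⟨1, -2, by ring⟩

end

end HalfEdgeGraph

end

theorem theorem4 {V E : Type*} [Fintype V] [DecidableEq V] [Fintype E]
    (G : HalfEdgeGraph V E) (σ : E → ℤˣ) (p : ℕ) (hp : 0 < p)
    (hG : G.OddEdgeConnected (2 * p + 1)) :
    G.AdmitsModuloCircularFlow σ (2 * p + 1) p ↔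
      G.AdmitsIntegerCircularFlow σ (2 * p + 1) p := by
  classical
  constructor
  · intro h
    obtain ⟨τ, hτ, hdvd⟩ := h.exists_orientation
    choose c hc using hdvd
    obtain ⟨S, hS⟩ := HalfEdgeGraph.exists_finset_sum_sign_eq_of_int hp hG hc
    refine ⟨τ, hτ, fun e => if e ∈ S then -(p + 1) else p, fun e => ?_, fun v => ?_⟩
    · have h1 : |(p : ℤ)| = p := abs_of_nonneg (by positivity)
      have h2 : |(-(p + 1) : ℤ)| = p + 1 := by rw [abs_neg, abs_of_nonneg (by positivity)]
      dsimp only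
      split_ifs
      · rw [h2]; push_cast; constructor <;> linarith
      · rw [h1]; push_cast; constructor <;> linarith
    · -- The flow is `-(p + 1)` everywhere plus `2 * p + 1` off `S`.
      have h1 : ∀ h : E × Bool, (if h.1 ∈ S then -(p + 1) else p : ℤ) * τ h =
          -(p + 1) * τ h + (2 * p + 1) * if h.1 ∉ S then (τ h : ℤ) else 0 := by
        intro h
        by_cases hh : h.1 ∈ S
        · simp [hh]
        · simp only [hh, if_false, not_false_eq_true, if_true]
          ring
      have h2 := hS v
      rw [← Finset.filter_filter, Finset.sum_filter] at h2
      simp only [HalfEdgeGraph.boundary, h1]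
      rw [Finset.sum_add_distrib, ← Finset.mul_sum, ← Finset.mul_sum, hc, h2]
      ring
  · rintro ⟨τ, hτ, f, hf, hbd⟩
    exact ⟨τ, hτ, f, hf, fun v => by rw [hbd v]⟩
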